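/- Theorem 7.9. Let $A$ be a commutative integral quantale, that is, a complete lattice (least element $0$, greatest element $1$) with a commutative associative multiplication that distributes over arbitrary joins and has $1$ as unit. Assume that $A$ is coherent: every element of $A$ is a join of compact elements, $1$ is compact, and the product of two compact elements is compact. Assume also that $A$ is normal: whenever $a\vee b=1$ there are $e,f\in A$ with $a\vee e=b\vee f=1$ and $ef=0$. Let $\mathrm{Spec}(A)$ be the set of $m$-prime elements of $A$ (those $p<1$ such that $ab\le p$ implies $a\le p$ or $b\le p$), and $\mathrm{Max}(A)\subseteq\mathrm{Spec}(A)$ the set of maximal elements (those maximal among the elements $<1$). The Zariski topology on $\mathrm{Spec}(A)$ has as closed sets the sets $\{p\in\mathrm{Spec}(A): a\le p\}$, $a\in A$; the flat topology on $\mathrm{Spec}(A)$ has as a basis of open sets the complements of the Zariski-compact Zariski-open subsets. Write $\mathrm{Spec}_F(A)$ for $\mathrm{Spec}(A)$ with the flat topology and $\mathrm{Max}_F(A)$ for $\mathrm{Max}(A)$ with the induced subspace topology. Let $\gamma:\mathrm{Spec}(A)\to\mathrm{Max}(A)$ be the retraction that sends each $p$ to the unique maximal element $m$ with $p\le m$ (it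 exists because $A$ is normal and coherent). Then $\gamma:\mathrm{Spec}_F(A)\to\mathrm{Max}_F(A)$ is continuous if and only if $\mathrm{Max}_F(A)$ is compact. -/

import Mathlib

/-!
Quantales are Mathlib's `IsQuantale`. A commutative integral quantale is a commutative monoid that
is a quantale and whose unit `1` is the top element. Compact elements are `IsCompactElement`, and
"algebraic" (every element is a join of compact elements) is `IsCompactlyGenerated`.
-/

namespace CoherentQuantale

/-- A coherent (commutative, integral) quantale: the unit is the top element, every element is a
join of compact elements, the unit is compact, and compact elements are closed under products. -/
class IsCoherentQuantale (A : Type*) [CommMonoid A] [CompleteLattice A] [IsQuantale A] : Prop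
    extends IsCompactlyGenerated A where
  one_eq_top : (1 : A) = ⊤
  isCompactElement_one : IsCompactElement (1 : A)
  isCompactElement_mul : ∀ c d : A, IsCompactElement c → IsCompactElement d →
    IsCompactElement (c * d)

/-- A quantale is normal if `a ⊔ b = 1` implies `a ⊔ e = b ⊔ f = 1` for some `e, f`
with `e * f = 0` (the least element). -/
class IsNormalQuantale (A : Type*) [CommMonoid A] [CompleteLattice A] [IsQuantale A] : Prop where
  exists_mul_eq_bot : ∀ a b : A, a ⊔ b = 1 → ∃ e f : A, a ⊔ e = 1 ∧ b ⊔ f = 1 ∧ e * f = ⊥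

section Basic

variable (A : Type*) [CommMonoid A] [CompleteLattice A]

/-- An element `p < 1` is `m`-prime if `a * b ≤ p` implies `a ≤ p` or `b ≤ p`. -/
def IsMPrime {A : Type*} [CommMonoid A] [CompleteLattice A] (p : A) : Prop :=
  p < 1 ∧ ∀ a b : A, a * b ≤ p → a ≤ p ∨ b ≤ p

/-- The set of `m`-prime elements. -/
def Spec : Type _ := {p : A // IsMPrime p}

/-- The set of maximal elements, i.e. elements maximal among those different from the top. -/
def Max (A : Type*) [CompleteLattice A] : Type _ := {m : A // IsCoatom m}

variable {A}

/-- `D a` is the set of `m`-primes `p` with `¬ a ≤ p`. -/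
def D (a : A) : Set (Spec A) := {p | ¬ a ≤ p.1}

end Basic

section Topology

variable (A : Type*) [CommMonoid A] [CompleteLattice A] [IsQuantale A] [IsCoherentQuantale A]

/-- The Zariski topology on `Spec A`: the open sets are the sets `D a`, equivalently
the closed sets are the sets `V a = {p | a ≤ p}`, for `a` in `A`. -/
@[reducible]
def zariskiTopology : TopologicalSpace (Spec A) where
  IsOpen U := ∃ a : A, U = D a
  isOpen_univ := by
    refine ⟨1, ?_⟩
    ext p
    simpa [D] using not_le_of_gt p.2.1
  isOpen_inter := by
    rintro _ _ ⟨a, rfl⟩ ⟨b, rfl⟩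
    refine ⟨a * b, ?_⟩
    ext p
    have h1 : a * b ≤ a := by
      calc a * b ≤ a * 1 := mul_le_mul_right (IsCoherentQuantale.one_eq_top (A := A) ▸ le_top) a
        _ = a := mul_one a
    have h2 : a * b ≤ b := by
      calc a * b ≤ 1 * b := mul_le_mul_left (IsCoherentQuantale.one_eq_top (A := A) ▸ le_top) b
        _ = b := one_mul b
    refine ⟨fun h hab => (p.2.2 a b hab).elim h.1 h.2, fun h => ⟨?_, ?_⟩⟩
    · exact fun ha => h (h1.trans ha)
    · exact fun hb => h (h2.trans hb)
  isOpen_sUnion := by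
    intro s hs
    refine ⟨sSup {a | D a ∈ s}, ?_⟩
    ext p
    constructor
    · rintro ⟨U, hU, hp⟩ hle
      obtain ⟨a, rfl⟩ := hs U hU
      have ha : a ≤ sSup {a | D a ∈ s} := le_sSup hU
      exact hp (ha.trans hle)
    · intro hp
      by_contra hcon
      exact hp (sSup_le fun a ha => by
        by_contra hap
        exact hcon ⟨D a, ha, hap⟩)

/-- The flat topology on `Spec A`: it has as a basis the complements of the compact open sets of
the Zariski topology. -/
@[reducible]
def flatTopology : TopologicalSpace (Spec A) :=
  TopologicalSpace.generateFrom
    {W | ∃ U : Set (Spec A), @IsOpen (Spec A) (zariskiTopology A) U ∧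
      @IsCompact (Spec A) (zariskiTopology A) U ∧ W = Uᶜ}

/-- The generating family of the flat topology is a basis. -/
theorem isTopologicalBasis_flatTopology :
    @TopologicalSpace.IsTopologicalBasis (Spec A) (flatTopology A)
      {W | ∃ U : Set (Spec A), @IsOpen (Spec A) (zariskiTopology A) U ∧
        @IsCompact (Spec A) (zariskiTopology A) U ∧ W = Uᶜ} := by
  let _ := flatTopology A
  refine ⟨?_, ?_, rfl⟩
  · rintro _ ⟨U, hU, hUc, rfl⟩ _ ⟨V, hV, hVc, rfl⟩ p hp
    refine ⟨(U ∪ V)ᶜ, ⟨U ∪ V, ?_, ?_, rfl⟩, ?_, ?_⟩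
    · exact @IsOpen.union _ _ _ (zariskiTopology A) hU hV
    · exact @IsCompact.union _ (zariskiTopology A) _ _ hUc hVc
    · rwa [Set.compl_union]
    · rw [Set.compl_union]
  · refine Set.eq_univ_of_forall fun p => ⟨Set.univ, ⟨∅, ?_, ?_, by simp⟩, trivial⟩
    · exact @isOpen_empty _ (zariskiTopology A)
    · exact @isCompact_empty _ (zariskiTopology A)

variable {A}

/-- Maximal elements are `m`-prime. -/
theorem isMPrime_of_isCoatom {m : A} (hm : IsCoatom m) : IsMPrime m := by
  have h1 : (1 : A) = ⊤ := IsCoherentQuantale.one_eq_top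
  refine ⟨h1 ▸ hm.lt_top, fun a b hab => ?_⟩
  by_contra! h
  have ha : m ⊔ a = ⊤ := hm.2 _ (left_lt_sup.2 h.1)
  refine h.2 ?_
  calc b = (m ⊔ a) * b := by rw [ha, ← h1, one_mul]
    _ = m * b ⊔ a * b := Quantale.sup_mul_distrib
    _ ≤ m := sup_le ?_ hab
  calc m * b ≤ m * 1 := mul_le_mul_right (h1 ▸ le_top) m
    _ = m := mul_one m

/-- The inclusion of `Max A` into `Spec A`. -/
def Max.toSpec (m : Max A) : Spec A := ⟨m.1, isMPrime_of_isCoatom m.2⟩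

variable (A) in
/-- The flat topology on `Max A`: the subspace topology induced by the flat topology
of `Spec A`. -/
@[reducible]
def maxFlatTopology : TopologicalSpace (Max A) :=
  TopologicalSpace.induced Max.toSpec (flatTopology A)

variable [IsNormalQuantale A]

/-- In a normal coherent quantale every `m`-prime lies below exactly one maximal element. -/
theorem existsUnique_max (p : Spec A) : ∃! m : Max A, p.1 ≤ m.1 := by
  have h1 : (1 : A) = ⊤ := IsCoherentQuantale.one_eq_top
  have hco : IsCoatomic A := CompleteLattice.coatomic_of_top_compact
    (h1 ▸ IsCoherentQuantale.isCompactElement_one)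
  have hp : p.1 ≠ ⊤ := h1 ▸ p.2.1.ne
  obtain ⟨m, hm, hpm⟩ := (hco.eq_top_or_exists_le_coatom p.1).resolve_left hp
  refine ⟨⟨m, hm⟩, hpm, fun n hn => ?_⟩
  by_contra hne
  have hne' : n.1 ≠ m := fun h => hne (Subtype.ext h)
  obtain ⟨e, f, he, hf, hef⟩ := IsNormalQuantale.exists_mul_eq_bot n.1 m
    (h1 ▸ n.2.sup_eq_top_of_ne hm hne')
  rcases p.2.2 e f (hef ▸ bot_le) with h | h
  · have h2 : e ≤ n.1 := h.trans hn
    exact n.2.1 (by rw [← h1, ← he, sup_eq_left.2 h2])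
  · exact hm.1 (by rw [← h1, ← hf, sup_eq_left.2 (h.trans hpm)])

/-- The map `γ : Spec A → Max A` sending an `m`-prime to the unique maximal element above it. -/
noncomputable def gamma (p : Spec A) : Max A := (existsUnique_max p).choose

/-- The defining property of `γ`. -/
theorem le_gamma (p : Spec A) : p.1 ≤ (gamma p).1 := (existsUnique_max p).choose_spec.1

/-- `γ` is a retraction of the inclusion of `Max A` into `Spec A`. -/
theorem gamma_toSpec (m : Max A) : gamma m.toSpec = m :=
  (existsUnique_max m.toSpec).unique (le_gamma m.toSpec) (le_refl m.1)

end Topology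

end CoherentQuantale

/-
Along an ultrafilter on `Spec A`, the join `q` of the elements that are eventually below `p` is
again `m`-prime, and a compact `c` satisfies `c ≤ q` if and only if `c ≤ p` eventually. So every
ultrafilter converges in the patch topology, whence the Zariski-compact open sets are the `D c` with
`c` compact, and `Spec A` is compact in the flat topology. If `γ` is continuous, its image `Max A`
is therefore compact.

Conversely, let `Max A` be compact and `c` be compact. Flat compactness of `{m | ¬ c ≤ m}` provides
a single `d` with `d ⊔ c = 1` such that `d ≤ m` whenever `¬ c ≤ m`. Normality, applied to
`d ⊔ c = 1`, gives `e` and `f` with `d ⊔ e = c ⊔ f = 1` and `e * f = 0`, where `e` may be shrunk to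
be compact. Then `c ≤ γ p` if and only if `e ≤ p`: an `m`-prime `p` lies above `e` or `f`, and `γ p`
cannot be above both `f` and `c`, nor above both `e` and `d`.
-/

namespace CoherentQuantale

open Filter Set TopologicalSpace Topology

section CompleteLattice

variable {A : Type*} [CompleteLattice A]

theorem le_liminf_iff_eventually_le {ι : Type*} {u : ι → A} {f : Filter ι} {c : A}
    (hc : IsCompactElement c) : c ≤ liminf u f ↔ ∀ᶠ i in f, c ≤ u i := by
  rw [liminf_eq]
  refine ⟨fun h => ?_, fun h => le_sSup h⟩
  have bot_mem : ⊥ ∈ {a | ∀ᶠ i in f, a ≤ u i} := Eventually.of_forall fun _ => bot_le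
  have directed : DirectedOn (· ≤ ·) {a | ∀ᶠ i in f, a ≤ u i} := fun a ha b hb =>
    ⟨a ⊔ b, (ha.and hb).mono fun _ h => sup_le h.1 h.2, le_sup_left, le_sup_right⟩
  obtain ⟨a, ha, hca⟩ := hc _ _ ⟨⊥, bot_mem⟩ directed (isLUB_sSup _) h
  exact ha.mono fun _ => hca.trans

variable [IsCompactlyGenerated A]

theorem exists_isCompactElement_le_not_le {a b : A} (h : ¬a ≤ b) :
    ∃ c, IsCompactElement c ∧ c ≤ a ∧ ¬c ≤ b := by
  simpa only [le_iff_compact_le_imp (a := a), not_forall, exists_prop] using h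

theorem exists_isCompactElement_le_sup {a b k : A} (hk : IsCompactElement k) (h : k ≤ a ⊔ b) :
    ∃ c, IsCompactElement c ∧ c ≤ a ∧ k ≤ c ⊔ b := by
  rw [← sSup_compact_le_eq a, sSup_eq_iSup'] at h
  have : Nonempty {c : A | IsCompactElement c ∧ c ≤ a} :=
    ⟨⊥, CompleteLattice.isCompactElement_finsetSup ∅ (f := id) (by simp), bot_le⟩
  obtain ⟨t, ht⟩ := CompleteLattice.IsCompactElement.exists_finset_of_le_iSup A hk _
    (h.trans_eq iSup_sup)
  exact ⟨t.sup Subtype.val, CompleteLattice.isCompactElement_finsetSup t fun c _ => c.2.1,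
    Finset.sup_le fun c _ => c.2.2,
    ht.trans (iSup₂_le fun c hc => sup_le_sup_right (Finset.le_sup (f := Subtype.val) hc) b)⟩

end CompleteLattice

section IntegralQuantale

variable {A : Type*} [Monoid A] [CompleteLattice A] [IsQuantale A]

theorem codisjoint_mul_left (h1 : (1 : A) = ⊤) {a b c : A} (ha : Codisjoint a c)
    (hb : Codisjoint b c) : Codisjoint (a * b) c := by
  have le_one (x : A) : x ≤ 1 := h1 ▸ le_top
  rw [codisjoint_iff_le_sup]
  calc ⊤ = (a ⊔ c) * (b ⊔ c) := by rw [ha.eq_top, hb.eq_top, ← h1, one_mul]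
    _ = (a * b ⊔ c * b) ⊔ (a ⊔ c) * c := by
      rw [Quantale.mul_sup_distrib, Quantale.sup_mul_distrib]
    _ ≤ a * b ⊔ c := sup_le (sup_le_sup_left (mul_le_of_le_one_right' (le_one b)) _)
      ((mul_le_of_le_one_left' (le_one _)).trans le_sup_right)

end IntegralQuantale

theorem mem_compl_D {A : Type*} [CommMonoid A] [CompleteLattice A] {a : A} {p : Spec A} :
    p ∈ (D a)ᶜ ↔ a ≤ p.1 :=
  not_not

variable {A : Type*} [CommMonoid A] [CompleteLattice A] [IsQuantale A] [IsCoherentQuantale A]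

theorem isCompactElement_top : IsCompactElement (⊤ : A) :=
  IsCoherentQuantale.one_eq_top (A := A) ▸ IsCoherentQuantale.isCompactElement_one

theorem exists_isCompactElement_codisjoint_mul_eq_bot [IsNormalQuantale A] {a b : A}
    (h : Codisjoint a b) :
    ∃ e f : A, IsCompactElement e ∧ Codisjoint e a ∧ Codisjoint f b ∧ e * f = ⊥ := by
  have h1 : (1 : A) = ⊤ := IsCoherentQuantale.one_eq_top
  obtain ⟨e, f, hae, hbf, hef⟩ :=
    IsNormalQuantale.exists_mul_eq_bot a b (h.eq_top.trans h1.symm)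
  obtain ⟨c, hc, hce, hca⟩ := exists_isCompactElement_le_sup isCompactElement_top
    (sup_comm a e ▸ h1.symm.trans hae.symm).le
  exact ⟨c, f, hc, codisjoint_iff_le_sup.2 hca, (codisjoint_iff.2 (hbf.trans h1)).symm,
    le_bot_iff.1 (hef ▸ mul_le_mul_left hce f)⟩

theorem isMPrime_liminf {ι : Type*} (F : Ultrafilter ι) {u : ι → A} (hu : ∀ i, IsMPrime (u i)) :
    IsMPrime (liminf u F) := by
  refine ⟨?_, fun a b hab => ?_⟩
  · rw [IsCoherentQuantale.one_eq_top, lt_top_iff_not_top_le,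
      le_liminf_iff_eventually_le isCompactElement_top]
    intro h
    obtain ⟨i, hi⟩ := h.exists
    exact (hu i).1.not_ge (le_top.trans hi)
  · by_contra! h
    obtain ⟨c, hc, hca, hcF⟩ := exists_isCompactElement_le_not_le h.1
    obtain ⟨d, hd, hdb, hdF⟩ := exists_isCompactElement_le_not_le h.2
    have hcd : ∀ᶠ i in F, c * d ≤ u i :=
      (le_liminf_iff_eventually_le (IsCoherentQuantale.isCompactElement_mul c d hc hd)).1
        ((mul_le_mul' hca hdb).trans hab)
    rw [le_liminf_iff_eventually_le hc] at hcF
    rw [le_liminf_iff_eventually_le hd] at hdF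
    exact (Ultrafilter.eventually_or.1 (hcd.mono fun i => (hu i).2 c d)).elim hcF hdF

/-- The limit of an ultrafilter on `Spec A` in the patch topology, obtained as the limit inferior
in `A` of the `m`-primes along the ultrafilter. -/
def ultrafilterLimit (F : Ultrafilter (Spec A)) : Spec A :=
  ⟨liminf (fun p : Spec A => p.1) F, isMPrime_liminf F fun p => p.2⟩

theorem le_ultrafilterLimit_iff {F : Ultrafilter (Spec A)} {c : A} (hc : IsCompactElement c) :
    c ≤ (ultrafilterLimit F).1 ↔ ∀ᶠ p : Spec A in F, c ≤ p.1 :=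
  le_liminf_iff_eventually_le hc

section Zariski

attribute [local instance] zariskiTopology

theorem le_nhds_ultrafilterLimit_zariskiTopology (F : Ultrafilter (Spec A)) :
    ↑F ≤ 𝓝 (ultrafilterLimit F) := by
  rw [le_nhds_iff]
  rintro _ hFa ⟨a, rfl⟩
  obtain ⟨c, hc, hca, hcF⟩ := exists_isCompactElement_le_not_le hFa
  rw [le_ultrafilterLimit_iff hc, ← Ultrafilter.eventually_not] at hcF
  exact hcF.mono fun p hcp hap => hcp (hca.trans hap)

theorem isCompact_D {c : A} (hc : IsCompactElement c) : IsCompact (D c) := by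
  refine isCompact_iff_ultrafilter_le_nhds.2 fun F hF =>
    ⟨ultrafilterLimit F, fun hcF => ?_, le_nhds_ultrafilterLimit_zariskiTopology F⟩
  exact Ultrafilter.eventually_not.1 (le_principal_iff.1 hF) ((le_ultrafilterLimit_iff hc).1 hcF)

theorem exists_isCompactElement_eq_D {U : Set (Spec A)} (hU : IsOpen U) (hUc : IsCompact U) :
    ∃ c : A, IsCompactElement c ∧ U = D c := by
  obtain ⟨a, rfl⟩ := hU
  obtain ⟨t, ht⟩ := hUc.elim_finite_subcover
    (fun c : {c : A // IsCompactElement c ∧ c ≤ a} => D c.1) (fun c => ⟨c.1, rfl⟩) fun p hp =>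
      let ⟨c, hc, hca, hcp⟩ := exists_isCompactElement_le_not_le hp
      mem_iUnion.2 ⟨⟨c, hc, hca⟩, hcp⟩
  refine ⟨t.sup Subtype.val, CompleteLattice.isCompactElement_finsetSup t fun c _ => c.2.1,
    subset_antisymm (ht.trans (iUnion₂_subset fun c hc p hcp htp => ?_)) fun p hp hap => ?_⟩
  · exact hcp ((Finset.le_sup (f := Subtype.val) hc).trans htp)
  · exact hp ((Finset.sup_le fun c _ => c.2.2).trans hap)

end Zariski

section Flat

attribute [local instance] flatTopology maxFlatTopology

variable (A) in
theorem isTopologicalBasis_compl_D :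
    IsTopologicalBasis ((fun c : A => (D c)ᶜ) '' {c | IsCompactElement c}) := by
  convert isTopologicalBasis_flatTopology A using 1
  ext W
  constructor
  · rintro ⟨c, hc, rfl⟩
    exact ⟨D c, ⟨c, rfl⟩, isCompact_D hc, rfl⟩
  · rintro ⟨U, hU, hUc, rfl⟩
    obtain ⟨c, hc, rfl⟩ := exists_isCompactElement_eq_D hU hUc
    exact ⟨c, hc, rfl⟩

theorem isOpen_compl_D {c : A} (hc : IsCompactElement c) : IsOpen (D c)ᶜ :=
  (isTopologicalBasis_compl_D A).isOpen ⟨c, hc, rfl⟩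

theorem le_nhds_ultrafilterLimit_flatTopology (F : Ultrafilter (Spec A)) :
    ↑F ≤ 𝓝 (ultrafilterLimit F) := by
  rw [(isTopologicalBasis_compl_D A).nhds_hasBasis.ge_iff]
  rintro _ ⟨⟨c, hc, rfl⟩, hcF⟩
  exact ((le_ultrafilterLimit_iff hc).1 (mem_compl_D.1 hcF)).mono fun _ => mem_compl_D.2

theorem compactSpace_spec : CompactSpace (Spec A) :=
  ⟨isCompact_iff_ultrafilter_le_nhds.2 fun F _ =>
    ⟨ultrafilterLimit F, mem_univ _, le_nhds_ultrafilterLimit_flatTopology F⟩⟩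

theorem isOpen_setOf_le {c : A} (hc : IsCompactElement c) : IsOpen {m : Max A | c ≤ m.1} := by
  convert (isOpen_compl_D hc).preimage (continuous_induced_dom (f := Max.toSpec (A := A))) using 1
  ext m
  exact (mem_compl_D (p := m.toSpec)).symm

theorem exists_codisjoint_forall_le_of_not_le [CompactSpace (Max A)] {c : A}
    (hc : IsCompactElement c) : ∃ d : A, Codisjoint d c ∧ ∀ m : Max A, ¬c ≤ m.1 → d ≤ m.1 := by
  have hclosed : IsClosed {m : Max A | ¬c ≤ m.1} := (isOpen_setOf_le hc).isClosed_compl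
  let ι := {d : A // IsCompactElement d ∧ Codisjoint d c}
  have : Nonempty ι := ⟨⊤, isCompactElement_top, codisjoint_top_left⟩
  have cover : {m : Max A | ¬c ≤ m.1} ⊆ ⋃ d : ι, {m | d.1 ≤ m.1} := by
    intro m hm
    obtain ⟨d, hd, hdm, hdc⟩ := exists_isCompactElement_le_sup isCompactElement_top
      (m.2.not_le_iff_codisjoint.1 hm).top_le
    exact mem_iUnion.2 ⟨⟨d, hd, codisjoint_iff_le_sup.2 hdc⟩, hdm⟩
  have le_one (x : A) : x ≤ 1 := IsCoherentQuantale.one_eq_top (A := A) ▸ le_top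
  have directed : Directed (· ⊆ ·) fun d : ι => {m : Max A | d.1 ≤ m.1} := fun d e =>
    ⟨⟨d.1 * e.1, IsCoherentQuantale.isCompactElement_mul _ _ d.2.1 e.2.1,
        codisjoint_mul_left IsCoherentQuantale.one_eq_top d.2.2 e.2.2⟩,
      fun _ => (mul_le_of_le_one_right' (le_one e.1)).trans,
      fun _ => (mul_le_of_le_one_left' (le_one d.1)).trans⟩
  obtain ⟨d, hd⟩ := hclosed.isCompact.elim_directed_cover _ (fun d : ι => isOpen_setOf_le d.2.1)
    cover directed
  exact ⟨d.1, d.2.2, fun _ hm => hd hm⟩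

variable [IsNormalQuantale A]

theorem exists_isCompactElement_le_gamma_iff [CompactSpace (Max A)] {c : A}
    (hc : IsCompactElement c) :
    ∃ e : A, IsCompactElement e ∧ ∀ p : Spec A, c ≤ (gamma p).1 ↔ e ≤ p.1 := by
  obtain ⟨d, hdc, hd⟩ := exists_codisjoint_forall_le_of_not_le hc
  obtain ⟨e, f, he, hed, hfc, hef⟩ := exists_isCompactElement_codisjoint_mul_eq_bot hdc
  refine ⟨e, he, fun p => ⟨fun hcp => ?_, fun hep => ?_⟩⟩
  · have hfp : ¬f ≤ p.1 := fun hfp =>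
      (gamma p).2.1 (top_le_iff.1 (hfc (hfp.trans (le_gamma p)) hcp))
    exact (p.2.2 e f (hef ▸ bot_le)).resolve_right hfp
  · by_contra hcp
    exact (gamma p).2.1 (top_le_iff.1 (hed (hep.trans (le_gamma p)) (hd _ hcp)))

theorem continuous_gamma [CompactSpace (Max A)] : Continuous (gamma : Spec A → Max A) := by
  refine continuous_induced_rng.2 ((isTopologicalBasis_compl_D A).continuous_iff.2 ?_)
  rintro _ ⟨c, hc, rfl⟩
  obtain ⟨e, he, hce⟩ := exists_isCompactElement_le_gamma_iff hc
  convert isOpen_compl_D he using 1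
  ext p
  exact mem_compl_D.trans ((hce p).trans mem_compl_D.symm)

theorem compactSpace_max_of_continuous_gamma (h : Continuous (gamma : Spec A → Max A)) :
    CompactSpace (Max A) :=
  have := compactSpace_spec (A := A)
  (Function.LeftInverse.surjective gamma_toSpec).compactSpace h

end Flat

end CoherentQuantale

theorem theorem7p9 {A : Type*} [CommMonoid A] [CompleteLattice A] [IsQuantale A]
    [CoherentQuantale.IsCoherentQuantale A] [CoherentQuantale.IsNormalQuantale A] :
    @Continuous (CoherentQuantale.Spec A) (CoherentQuantale.Max A)
        (CoherentQuantale.flatTopology A) (CoherentQuantale.maxFlatTopology A)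
        CoherentQuantale.gamma ↔
      @CompactSpace (CoherentQuantale.Max A) (CoherentQuantale.maxFlatTopology A) :=
  ⟨CoherentQuantale.compactSpace_max_of_continuous_gamma,
    fun _ => CoherentQuantale.continuous_gamma⟩
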